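/- **Theorem 3.7.** All rings are commutative, an extension $A\supseteq D$ of integral domains means an integral domain $A$ containing $D$ as a subring, and $K$, $L$ denote the quotient fields of $D$, $A$. Put $\mathrm{Int}(D,A)=\{f\in L[X] : f(D)\subseteq A\}$ and $\mathrm{Int}(D)=\mathrm{Int}(D,D)$. The extension $A\supseteq D$ is *polynomially regular* if $\mathrm{Int}(D,A)$ is generated by $\mathrm{Int}(D)$ as an $A$-module. For a nonzero fractional ideal $I$ of $D$ let $I^{-1}=\{x\in K: xI\subseteq D\}$, $I_v=(I^{-1})^{-1}$, and $I_t=\bigcup J_v$, where $J$ ranges over the nonzero finitely generated fractional ideals contained in $I$; $I$ is a *$t$-ideal* if $I=I_t$. A *$t$-maximal* ideal is an ideal that is maximal among the (nonzero) $t$-ideals properly contained in $D$; such an ideal is prime. The extension $A\supseteq D$ is *$t$-linked* if $I_t=D$ implies $(IA)_t=A$ for every nonzero ideal $I$ of $D$. The domain $D$ is - *polynomially $t$-regular* if every $t$-linked extension of $D$ is polynomially regular; - *absolutely polynomially regular* if every extension of $D$ is polynomially regular; - *polynomially L-regular* if $\mathrm{Int}(S^{-1}D)=S^{-1}\mathrm{Int}(D)$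 (inside $K[X]$) for every multiplicative subset $S\subseteq D\setminus\{0\}$ of $D$. Let $D$ be an integral domain, and consider the following conditions. (a) $D$ is polynomially $t$-regular. (b) $D$ is polynomially L-regular and $D_{\mathfrak p}$ is polynomially $t$-regular for every prime ideal $\mathfrak p$ of $D$. (c) $D$ is polynomially L-regular and $D_{\mathfrak p}$ is absolutely polynomially regular for every $t$-maximal ideal $\mathfrak p$ of $D$. Then (a) implies (b), and (a) implies (c). Moreover, if $D$ is infinite and $\mathrm{Int}(D)$ is flat as a $D$-module, then (a) and (c) are equivalent. -/

import Mathlib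

open scoped nonZeroDivisors Polynomial

universe u

noncomputable section

namespace IntegerValued

/-! ### Integer-valued polynomials -/

/-- The ring `{f ∈ L[X] : f(E) ⊆ B}` of polynomials over a field `L` that map a subset `E` of `L`
into a subring `B` of `L`. -/
def polysInto {R L : Type*} [CommRing R] [Field L] [Algebra R L] (E : Set L)
    (B : Subalgebra R L) : Subalgebra R L[X] where
  carrier := {f | ∀ x ∈ E, f.eval x ∈ B}
  mul_mem' hf hg x hx := by
    rw [Polynomial.eval_mul]; exact B.mul_mem (hf x hx) (hg x hx)
  add_mem' hf hg x hx := by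
    rw [Polynomial.eval_add]; exact B.add_mem (hf x hx) (hg x hx)
  algebraMap_mem' r x _ := by
    rw [Polynomial.algebraMap_apply, Polynomial.eval_C]; exact B.algebraMap_mem r

/-- `Int(D, A) = {f ∈ L[X] : f(D) ⊆ A}`, where `L` is the quotient field of `A`, as an
`A`-subalgebra of `L[X]`. -/
def IntPoly (D A : Type*) [CommRing D] [CommRing A] [IsDomain A] [Algebra D A] :
    Subalgebra A (FractionRing A)[X] :=
  polysInto (Set.range fun d : D => algebraMap A (FractionRing A) (algebraMap D A d)) ⊥

/-- An extension `A ⊇ D` of domains (given by an injective structure map `D → A`) is *polynomially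
regular* if `Int(D, A)` is generated as an `A`-module by `Int(D) = Int(D, D)`. The inclusion
`K[X] ⊆ L[X]` is the one induced by the inclusion `K ⊆ L` of quotient fields. -/
def PolynomiallyRegular (D A : Type*) [CommRing D] [IsDomain D] [CommRing A] [IsDomain A]
    [Algebra D A] (h : Function.Injective (algebraMap D A)) : Prop :=
  Submodule.span A
      (Polynomial.map (IsFractionRing.map (K := FractionRing D) (L := FractionRing A) h) ''
        (IntPoly D D : Set (FractionRing D)[X])) =
    Subalgebra.toSubmodule (IntPoly D A)

/-! ### `t`-closure and `t`-linked extensions -/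

section TClosure

variable {D : Type*} [CommRing D] [IsDomain D]

/-- The `t`-closure `I_t = ⋃ J_v` of a fractional ideal `I` of `D`, where `J` ranges over the
nonzero finitely generated fractional ideals contained in `I`, and `J_v = (J⁻¹)⁻¹`. -/
def tClosure (I : FractionalIdeal D⁰ (FractionRing D)) : Set (FractionRing D) :=
  {x | ∃ J : FractionalIdeal D⁰ (FractionRing D),
    J ≠ 0 ∧ (J : Submodule D (FractionRing D)).FG ∧ J ≤ I ∧ x ∈ (J⁻¹)⁻¹}

/-- A (fractional) `t`-ideal: a nonzero fractional ideal `I` with `I_t = I`. -/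
def IsTIdeal (I : FractionalIdeal D⁰ (FractionRing D)) : Prop :=
  I ≠ 0 ∧ tClosure I = (I : Set (FractionRing D))

/-- A `t`-maximal ideal: an ideal that is maximal among the `t`-ideals properly contained
in `D`. -/
def IsTMaximal (p : Ideal D) : Prop :=
  Maximal (fun I : Ideal D => I ≠ ⊤ ∧ IsTIdeal (I : FractionalIdeal D⁰ (FractionRing D))) p

end TClosure

/-- The extension `A ⊇ D` is *`t`-linked* if `I_t = D` implies `(IA)_t = A` for every nonzero
ideal `I` of `D`. -/
def TLinked (D A : Type*) [CommRing D] [IsDomain D] [CommRing A] [IsDomain A]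
    [Algebra D A] : Prop :=
  ∀ I : Ideal D, I ≠ ⊥ →
    tClosure (I : FractionalIdeal D⁰ (FractionRing D)) =
        ((1 : FractionalIdeal D⁰ (FractionRing D)) : Set (FractionRing D)) →
      tClosure ((I.map (algebraMap D A) : Ideal A) : FractionalIdeal A⁰ (FractionRing A)) =
        ((1 : FractionalIdeal A⁰ (FractionRing A)) : Set (FractionRing A))

/-! ### Regularity conditions on a domain -/

/-- `D` is *absolutely polynomially regular*: every extension of `D` is polynomially regular. -/
def AbsolutelyPolynomiallyRegular (D : Type u) [CommRing D] [IsDomain D] : Prop :=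
  ∀ (A : Type u) [CommRing A] [IsDomain A] [Algebra D A]
    (h : Function.Injective (algebraMap D A)), PolynomiallyRegular D A h

/-- `D` is *polynomially `t`-regular*: every `t`-linked extension of `D` is polynomially
regular. -/
def PolynomiallyTRegular (D : Type u) [CommRing D] [IsDomain D] : Prop :=
  ∀ (A : Type u) [CommRing A] [IsDomain A] [Algebra D A]
    (h : Function.Injective (algebraMap D A)), TLinked D A → PolynomiallyRegular D A h

/-- `D` is *polynomially L-regular*: `Int(S⁻¹D) = S⁻¹Int(D)`, as subsets of `K[X]`, for every
multiplicative subset `S` of `D` (not containing `0`), where `S⁻¹D ⊆ K`. A polynomial `f` lies in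
`S⁻¹Int(D)` if and only if `s • f` lies in `Int(D)` for some `s ∈ S`. -/
def PolynomiallyLRegular (D : Type*) [CommRing D] [IsDomain D] : Prop :=
  ∀ (S : Submonoid D) (hS : S ≤ D⁰),
    (polysInto (Localization.subalgebra.ofField (FractionRing D) S hS : Set (FractionRing D))
        (Localization.subalgebra.ofField (FractionRing D) S hS) : Set (FractionRing D)[X]) =
      {f | ∃ s ∈ S, s • f ∈ IntPoly D D}

end IntegerValued

end

/-! The t-operation enters only through Glaz–Vasconcelos (GV) ideals: `I_t = D` exactly when `I`
contains a GV ideal (`tClosure_eq_one_iff`), so t-linkedness says that the extension of a GV ideal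
again contains one (`tLinked_iff`). By Zorn, a nonzero ideal containing no GV ideal lies in a prime
t-maximal one (`exists_le_isTMaximal`).

From (a): localizations are t-linked and t-linkedness is transitive, which gives L-regularity and
the t-regularity of every `D_p`. If `p` is t-maximal, it contains no GV ideal, so GV ideals blow up
in `D_p`; every extension of `D_p` is then t-linked over `D`.

From (c) to (a): let `f ∈ Int(D, A)`, let `M` be the `A`-span of `Int(D)`, and let `I = {a : a f ∈
M}`. Flatness identifies `M` with `A ⊗ Int(D)` and makes it closed under division by GV ideals
(`IsGV.mem_span_range`), so if `f ∉ M` then `I` lies in a t-maximal `q` of `A`. By t-linkedness `q ∩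
D` lies in a t-maximal `m` of `D`. Since `D_m` is absolutely regular, `f` is in the `A_q`-span of
`Int(D_m)`, and L-regularity clears denominators: `u f ∈ M` for some `u ∉ q`, contradicting `I ⊆ q`.
A field has no t-maximal ideals; there Lagrange interpolation replaces the argument and uses that
`D` is infinite. -/

noncomputable section

namespace IntegerValued

/-! ### Glaz–Vasconcelos ideals -/

section GV
variable {D : Type*} [CommRing D]

/-- Glaz–Vasconcelos ideals: finitely generated ideals `J` with `J⁻¹ = D`, stated in terms of
divisibility. -/
def IsGV (J : Ideal D) : Prop :=
  J.FG ∧ ∀ a d : D, (∀ j ∈ J, d ∣ a * j) → d ∣ a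

lemma isGV_top : IsGV (⊤ : Ideal D) :=
  ⟨⟨{1}, by simp⟩, fun a d h => by simpa using h 1 trivial⟩

lemma IsGV.mul {I J : Ideal D} (hI : IsGV I) (hJ : IsGV J) : IsGV (I * J) :=
  ⟨hI.1.mul hJ.1, fun a d h => hI.2 a d fun i hi => hJ.2 _ _ fun j hj => by
    rw [mul_assoc]; exact h _ (Ideal.mul_mem_mul hi hj)⟩

lemma IsGV.ne_bot [Nontrivial D] {J : Ideal D} (hJ : IsGV J) : J ≠ ⊥ := by
  rintro rfl
  have := hJ.2 1 0 (by simp)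
  simp at this

/-- A finitely generated ideal below `I ⊔ N` lies below `H ⊔ N` for a finitely generated `H ≤ I`. -/
lemma exists_fg_le_sup {J I N : Ideal D} (hJ : J.FG) (h : J ≤ I ⊔ N) :
    ∃ H ≤ I, H.FG ∧ J ≤ H ⊔ N := by
  revert h
  refine Submodule.fg_induction
    (motive := fun J _ => J ≤ I ⊔ N → ∃ H ≤ I, Submodule.FG H ∧ J ≤ H ⊔ N) ?_ ?_ J hJ
  · intro x hx
    obtain ⟨y, hy, z, hz, rfl⟩ := Submodule.mem_sup.1 (hx (Submodule.mem_span_singleton_self x))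
    refine ⟨Ideal.span {y}, (Ideal.span_singleton_le_iff_mem I).2 hy, ⟨{y}, by simp⟩, ?_⟩
    rw [Submodule.span_singleton_le_iff_mem]
    exact Submodule.add_mem_sup (Ideal.mem_span_singleton_self y) hz
  · intro J₁ J₂ _ _ h₁ h₂ h
    obtain ⟨H₁, h1, f1, l1⟩ := h₁ (le_sup_left.trans h)
    obtain ⟨H₂, h2, f2, l2⟩ := h₂ (le_sup_right.trans h)
    exact ⟨H₁ ⊔ H₂, sup_le h1 h2, f1.sup f2,
      sup_le (l1.trans (sup_le_sup_right le_sup_left _))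
        (l2.trans (sup_le_sup_right le_sup_right _))⟩

/-- Zorn applies because GV ideals are finitely generated: one lying in the union of a chain already
lies in a member of it. -/
lemma exists_le_maximal_not_isGV {I : Ideal D} (hI : ∀ J ≤ I, ¬ IsGV J) :
    ∃ m, I ≤ m ∧ Maximal (fun m : Ideal D => ∀ J ≤ m, ¬ IsGV J) m := by
  refine zorn_le_nonempty₀ {m : Ideal D | ∀ J ≤ m, ¬ IsGV J} ?_ I hI
  intro c hc hch y hy
  refine ⟨sSup c, ?_, fun z hz => le_sSup hz⟩
  intro J hJ hGV
  obtain ⟨x, hx, hJx⟩ := (CompleteLattice.isCompactElement_iff_le_of_directed_sSup_le _ J).1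
    ((Submodule.fg_iff_compact J).1 hGV.1) c ⟨y, hy⟩ hch.directedOn hJ
  exact hc hx J hJx hGV

/-- If `a, b ∉ m` but `ab ∈ m`, the product of GV ideals inside `m + (a)` and `m + (b)` is a GV
ideal inside `m`. -/
lemma isPrime_of_maximal_not_isGV {m : Ideal D}
    (hm : Maximal (fun m : Ideal D => ∀ J ≤ m, ¬ IsGV J) m) : m.IsPrime := by
  have key : ∀ a ∉ m, ∃ J ≤ m ⊔ Ideal.span {a}, IsGV J := by
    intro a ha
    by_contra! hcon
    exact ha (hm.2 hcon le_sup_left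
      (Ideal.mem_sup_right (Ideal.mem_span_singleton_self a)))
  refine ⟨fun h => hm.1 ⊤ h.ge isGV_top, fun {a b} hab => ?_⟩
  by_contra! h
  obtain ⟨J₁, h1, g1⟩ := key a h.1
  obtain ⟨J₂, h2, g2⟩ := key b h.2
  refine hm.1 (J₁ * J₂) ((Ideal.mul_mono h1 h2).trans ?_) (g1.mul g2)
  rw [Ideal.sup_mul, Ideal.mul_sup, Ideal.mul_sup, Ideal.span_singleton_mul_span_singleton]
  refine sup_le (sup_le Ideal.mul_le_left Ideal.mul_le_left) (sup_le Ideal.mul_le_right ?_)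
  rwa [Ideal.span_singleton_le_iff_mem]

lemma exists_common_multiplier (S : Submonoid D) {J : Ideal D} (hJ : J.FG) (a d : D)
    (h : ∀ j ∈ J, ∃ s ∈ S, d ∣ s * (a * j)) : ∃ s ∈ S, ∀ j ∈ J, d ∣ s * (a * j) := by
  revert h
  refine Submodule.fg_induction (motive := fun J _ => (∀ j ∈ J, ∃ s ∈ S, d ∣ s * (a * j)) →
    ∃ s ∈ S, ∀ j ∈ J, d ∣ s * (a * j)) ?_ ?_ J hJ
  · intro x hx
    obtain ⟨s, hs, hd⟩ := hx x (Submodule.mem_span_singleton_self x)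
    refine ⟨s, hs, fun j hj => ?_⟩
    obtain ⟨c, rfl⟩ := Submodule.mem_span_singleton.1 hj
    have : s * (a * c • x) = s * (a * x) * c := by rw [smul_eq_mul]; ring
    rw [this]; exact hd.mul_right c
  · intro J₁ J₂ _ _ h₁ h₂ h
    obtain ⟨s, hs, h1⟩ := h₁ fun j hj => h j (Submodule.mem_sup_left hj)
    obtain ⟨t, ht, h2⟩ := h₂ fun j hj => h j (Submodule.mem_sup_right hj)
    refine ⟨s * t, S.mul_mem hs ht, fun j hj => ?_⟩
    obtain ⟨y, hy, z, hz, rfl⟩ := Submodule.mem_sup.1 hj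
    have : s * t * (a * (y + z)) = s * (a * y) * t + t * (a * z) * s := by ring
    rw [this]
    exact ((h1 y hy).mul_right _).add ((h2 z hz).mul_right _)

/-- Finite generation provides one denominator from `S` that works for all `j ∈ J` at once, so the
divisibility test descends to `D`, where `J` is GV. -/
lemma IsGV.map_localization (S : Submonoid D) (B : Type*) [CommRing B] [Algebra D B]
    [IsLocalization S B] {J : Ideal D} (hJ : IsGV J) : IsGV (J.map (algebraMap D B)) := by
  refine ⟨hJ.1.map _, fun a d h => ?_⟩
  obtain ⟨⟨a₀, s⟩, ha⟩ := IsLocalization.surj S a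
  obtain ⟨⟨d₀, t⟩, hd⟩ := IsLocalization.surj S d
  simp only at ha hd
  have hs := IsLocalization.map_units B s
  have ht := IsLocalization.map_units B t
  obtain ⟨u, hu, hdiv⟩ := exists_common_multiplier S hJ.1 a₀ d₀ (fun j hj => by
    obtain ⟨c, hc⟩ := h _ (Ideal.mem_map_of_mem _ hj)
    obtain ⟨⟨c₀, r⟩, hc₀⟩ := IsLocalization.surj S c
    simp only at hc₀
    have e : algebraMap D B (r * t * (a₀ * j)) = algebraMap D B (d₀ * (c₀ * s)) := by
      simp only [map_mul, ← ha, ← hd, ← hc₀]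
      linear_combination (algebraMap D B r * algebraMap D B t * algebraMap D B s) * hc
    obtain ⟨v, hv⟩ := (IsLocalization.eq_iff_exists S B).1 e
    exact ⟨v * (r * t), S.mul_mem v.2 (S.mul_mem r.2 t.2), c₀ * s * v, by
      rw [mul_assoc (v : D), hv]; ring⟩)
  have h1 : d₀ ∣ u * a₀ := hJ.2 _ _ fun j hj => by rw [mul_assoc]; exact hdiv j hj
  have h2 := map_dvd (algebraMap D B) h1
  rw [map_mul, ← ha, ← hd, ht.mul_right_dvd] at h2
  rwa [(IsLocalization.map_units B ⟨u, hu⟩).dvd_mul_left, hs.dvd_mul_right] at h2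

lemma ne_zero_of_mem_of_ne_zero {J : FractionalIdeal D⁰ (FractionRing D)} {x : FractionRing D}
    (hx : x ∈ J) (h : x ≠ 0) : J ≠ 0 := by
  rintro rfl
  exact h ((FractionalIdeal.mem_zero_iff _).1 hx)

end GV

/-! ### t-closure, t-maximal ideals and t-linkedness through GV ideals -/

section TClosure
variable {D : Type*} [CommRing D] [IsDomain D]

lemma one_mem_inv {J : FractionalIdeal D⁰ (FractionRing D)} (h0 : J ≠ 0) (h : J ≤ 1) :
    (1 : FractionRing D) ∈ J⁻¹ :=
  (FractionalIdeal.mem_inv_iff h0).2 fun y hy => by rw [one_mul]; exact h hy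

lemma mem_inv_inv_iff {J : FractionalIdeal D⁰ (FractionRing D)} (h0 : J ≠ 0) (h : J ≤ 1)
    (x : FractionRing D) : x ∈ J⁻¹⁻¹ ↔
      ∀ y ∈ J⁻¹, x * y ∈ (1 : FractionalIdeal D⁰ (FractionRing D)) :=
  FractionalIdeal.mem_inv_iff (ne_zero_of_mem_of_ne_zero (one_mem_inv h0 h) one_ne_zero)

lemma IsGV.inv_le_one {J : Ideal D} (hJ : IsGV J) :
    (J : FractionalIdeal D⁰ (FractionRing D))⁻¹ ≤ 1 := by
  intro x hx
  rw [FractionalIdeal.mem_inv_iff (FractionalIdeal.coeIdeal_ne_zero.2 hJ.ne_bot)] at hx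
  obtain ⟨a, d, hd, rfl⟩ := IsFractionRing.div_surjective (A := D) x
  have hd0 : algebraMap D (FractionRing D) d ≠ 0 :=
    IsFractionRing.to_map_ne_zero_of_mem_nonZeroDivisors hd
  obtain ⟨c, hc⟩ := hJ.2 a d fun j hj => by
    obtain ⟨b, hb⟩ := (FractionalIdeal.mem_one_iff _).1
      (hx _ (FractionalIdeal.mem_coeIdeal_of_mem _ hj))
    refine ⟨b, IsFractionRing.injective D (FractionRing D) ?_⟩
    rw [map_mul, map_mul, hb]
    field_simp
  refine (FractionalIdeal.mem_one_iff _).2 ⟨c, ?_⟩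
  rw [hc, map_mul]
  field_simp

lemma isGV_of_inv_le_one {J : Ideal D} (hfg : J.FG) (h0 : J ≠ ⊥)
    (h : (J : FractionalIdeal D⁰ (FractionRing D))⁻¹ ≤ 1) : IsGV J := by
  refine ⟨hfg, fun a d hd => ?_⟩
  obtain ⟨j, hj, hj0⟩ := Submodule.exists_mem_ne_zero_of_ne_bot h0
  rcases eq_or_ne d 0 with rfl | hd0
  · have := hd j hj
    rw [zero_dvd_iff] at this ⊢
    exact (mul_eq_zero.1 this).resolve_right hj0
  have hd0' : algebraMap D (FractionRing D) d ≠ 0 :=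
    fun e => hd0 ((IsFractionRing.to_map_eq_zero_iff).1 e)
  have : algebraMap D (FractionRing D) a / algebraMap D (FractionRing D) d ∈
      (J : FractionalIdeal D⁰ (FractionRing D))⁻¹ := by
    rw [FractionalIdeal.mem_inv_iff (FractionalIdeal.coeIdeal_ne_zero.2 h0)]
    intro y hy
    obtain ⟨k, hk, rfl⟩ := (FractionalIdeal.mem_coeIdeal _).1 hy
    obtain ⟨c, hc⟩ := hd k hk
    refine (FractionalIdeal.mem_one_iff _).2 ⟨c, ?_⟩
    rw [div_mul_eq_mul_div, ← map_mul, hc, map_mul]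
    field_simp
  obtain ⟨c, hc⟩ := (FractionalIdeal.mem_one_iff _).1 (h this)
  refine ⟨c, IsFractionRing.injective D (FractionRing D) ?_⟩
  rw [map_mul, hc]
  field_simp

lemma tClosure_eq_one_iff (I : Ideal D) :
    tClosure (I : FractionalIdeal D⁰ (FractionRing D)) =
      ((1 : FractionalIdeal D⁰ (FractionRing D)) : Set (FractionRing D)) ↔
    ∃ J ≤ I, IsGV J := by
  constructor
  · intro h
    have h1 : (1 : FractionRing D) ∈ tClosure (I : FractionalIdeal D⁰ (FractionRing D)) := by
      rw [h]; exact FractionalIdeal.one_mem_one _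
    obtain ⟨J, h0, hfg, hle, hmem⟩ := h1
    obtain ⟨J, rfl⟩ := FractionalIdeal.le_one_iff_exists_coeIdeal.1
      (hle.trans FractionalIdeal.coeIdeal_le_one)
    rw [mem_inv_inv_iff h0 FractionalIdeal.coeIdeal_le_one] at hmem
    refine ⟨J, (FractionalIdeal.coeIdeal_le_coeIdeal _).1 hle, isGV_of_inv_le_one ?_ ?_ ?_⟩
    · rw [FractionalIdeal.coe_coeIdeal] at hfg
      exact (FractionalIdeal.coeIdeal_fg D⁰ (IsFractionRing.injective D (FractionRing D)) J).1 hfg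
    · exact FractionalIdeal.coeIdeal_ne_zero.1 h0
    · intro y hy
      simpa using hmem y hy
  · rintro ⟨J, hJI, hJ⟩
    ext x
    constructor
    · rintro ⟨J', h0, -, hle, hx⟩
      have hle1 := hle.trans FractionalIdeal.coeIdeal_le_one
      rw [mem_inv_inv_iff h0 hle1] at hx
      simpa using hx 1 (one_mem_inv h0 hle1)
    · intro hx
      have h0 := FractionalIdeal.coeIdeal_ne_zero (K := FractionRing D).2 hJ.ne_bot
      refine ⟨J, h0, ?_, (FractionalIdeal.coeIdeal_le_coeIdeal _).2 hJI, ?_⟩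
      · rw [FractionalIdeal.coe_coeIdeal]
        exact (FractionalIdeal.coeIdeal_fg D⁰
          (IsFractionRing.injective D (FractionRing D)) J).2 hJ.1
      · rw [mem_inv_inv_iff h0 FractionalIdeal.coeIdeal_le_one]
        intro y hy
        simpa using FractionalIdeal.mul_mem_mul hx (hJ.inv_le_one hy)

lemma tLinked_iff {A : Type*} [CommRing A] [IsDomain A] [Algebra D A] :
    TLinked D A ↔ ∀ J : Ideal D, IsGV J → ∃ H ≤ J.map (algebraMap D A), IsGV H := by
  simp only [TLinked, tClosure_eq_one_iff]
  constructor
  · intro h J hJ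
    exact h J hJ.ne_bot ⟨J, le_rfl, hJ⟩
  · rintro h I - ⟨J, hJI, hJ⟩
    obtain ⟨H, hH, hGV⟩ := h J hJ
    exact ⟨H, hH.trans (Ideal.map_mono hJI), hGV⟩

lemma IsTMaximal.not_isGV {p : Ideal D} (hp : IsTMaximal p) (J : Ideal D) (hJ : J ≤ p) :
    ¬ IsGV J := by
  intro h
  have h1 := (tClosure_eq_one_iff p).2 ⟨J, hJ, h⟩
  rw [hp.1.2.2] at h1
  have h2 : ((p : FractionalIdeal D⁰ (FractionRing D))) = 1 := SetLike.coe_injective h1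
  exact hp.1.1 ((FractionalIdeal.coeIdeal_eq_one.1 h2).trans Ideal.one_eq_top)

/-- The substance is that `m` is a t-ideal; maximality is then immediate, since a proper t-ideal
contains no GV ideal. -/
lemma isTMaximal_of_maximal_not_isGV {m : Ideal D} (h0 : m ≠ ⊥)
    (hm : Maximal (fun m : Ideal D => ∀ J ≤ m, ¬ IsGV J) m) : IsTMaximal m := by
  have hcoe : (m : FractionalIdeal D⁰ (FractionRing D)) ≠ 0 :=
    FractionalIdeal.coeIdeal_ne_zero.2 h0
  refine ⟨⟨fun h => hm.1 ⊤ h.ge isGV_top, hcoe, ?_⟩, ?_⟩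
  · ext x
    constructor
    · rintro ⟨J, hJ0, hfg, hle, hx⟩
      obtain ⟨J, rfl⟩ := FractionalIdeal.le_one_iff_exists_coeIdeal.1
        (hle.trans FractionalIdeal.coeIdeal_le_one)
      have hle' := (FractionalIdeal.coeIdeal_le_coeIdeal _).1 hle
      rw [FractionalIdeal.coe_coeIdeal] at hfg
      replace hfg := (FractionalIdeal.coeIdeal_fg D⁰
        (IsFractionRing.injective D (FractionRing D)) J).1 hfg
      rw [mem_inv_inv_iff hJ0 FractionalIdeal.coeIdeal_le_one] at hx
      obtain ⟨x, rfl⟩ := (FractionalIdeal.mem_one_iff D⁰).1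
        (by simpa only [mul_one] using hx 1 (one_mem_inv hJ0 FractionalIdeal.coeIdeal_le_one))
      by_contra hxm
      have hxm' : x ∉ m := fun h => hxm (FractionalIdeal.mem_coeIdeal_of_mem _ h)
      -- Here `x ∈ J_v` with `J ≤ m`. If `x ∉ m`, a GV ideal `J'` lies in `H + (x)` with `H ≤ m`
      -- finitely generated. Any `y ∈ (H + J)⁻¹` satisfies `yx ∈ D`, hence `y ∈ J'⁻¹ = D`; so `H +
      -- J` is a GV ideal inside `m`.
      obtain ⟨J', hJ', hGV⟩ : ∃ J' ≤ m ⊔ Ideal.span {x}, IsGV J' := by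
        by_contra! hcon
        exact hxm' (hm.2 hcon le_sup_left
          (Ideal.mem_sup_right (Ideal.mem_span_singleton_self x)))
      obtain ⟨H, hHm, hHfg, hJH⟩ := exists_fg_le_sup hGV.1 hJ'
      have hne : H ⊔ J ≠ ⊥ := fun h => FractionalIdeal.coeIdeal_ne_zero.1 hJ0
        (le_bot_iff.1 (le_sup_right.trans h.le))
      refine hm.1 (H ⊔ J) (sup_le hHm hle')
        (isGV_of_inv_le_one (Submodule.FG.sup hHfg hfg) hne fun y hy => hGV.inv_le_one ?_)
      rw [FractionalIdeal.mem_inv_iff (FractionalIdeal.coeIdeal_ne_zero.2 hne)] at hy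
      rw [FractionalIdeal.mem_inv_iff (FractionalIdeal.coeIdeal_ne_zero.2 hGV.ne_bot)]
      have hyx : algebraMap D _ x * y ∈ (1 : FractionalIdeal D⁰ (FractionRing D)) := by
        refine hx y ((FractionalIdeal.mem_inv_iff hJ0).2 fun z hz => hy z ?_)
        exact (FractionalIdeal.coeIdeal_le_coeIdeal _).2 le_sup_right hz
      intro z hz
      obtain ⟨z, hz', rfl⟩ := (FractionalIdeal.mem_coeIdeal _).1 hz
      obtain ⟨h, hh, w, hw, rfl⟩ := Submodule.mem_sup.1 (hJH hz')
      obtain ⟨c, rfl⟩ := Ideal.mem_span_singleton.1 hw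
      have h1 := hy _ (FractionalIdeal.mem_coeIdeal_of_mem _ (Ideal.mem_sup_left hh))
      obtain ⟨b₁, h1⟩ := (FractionalIdeal.mem_one_iff _).1 h1
      obtain ⟨b₂, h2⟩ := (FractionalIdeal.mem_one_iff _).1 hyx
      refine (FractionalIdeal.mem_one_iff _).2 ⟨b₁ + b₂ * c, ?_⟩
      simp only [map_add, map_mul, h1, h2]
      ring
    · intro hx
      obtain ⟨x, hx, rfl⟩ := (FractionalIdeal.mem_coeIdeal _).1 hx
      -- The extra generator `j` keeps the finitely generated ideal nonzero when `x = 0`.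
      obtain ⟨j, hj, hj0⟩ := Submodule.exists_mem_ne_zero_of_ne_bot h0
      have hne : Ideal.span {x, j} ≠ ⊥ := fun h => hj0 (by
        have : j ∈ Ideal.span {x, j} := Ideal.subset_span (by simp)
        rwa [h] at this)
      have hle : Ideal.span {x, j} ≤ m := by
        rw [Ideal.span_le]
        rintro y (rfl | rfl) <;> assumption
      have hne' := FractionalIdeal.coeIdeal_ne_zero (K := FractionRing D).2 hne
      refine ⟨Ideal.span {x, j}, hne', ?_, (FractionalIdeal.coeIdeal_le_coeIdeal _).2 hle, ?_⟩
      · rw [FractionalIdeal.coe_coeIdeal]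
        exact (FractionalIdeal.coeIdeal_fg D⁰ (IsFractionRing.injective D (FractionRing D)) _).2
          (Submodule.fg_span (by simp))
      · rw [mem_inv_inv_iff hne' FractionalIdeal.coeIdeal_le_one]
        intro y hy
        rw [mul_comm]
        exact (FractionalIdeal.mem_inv_iff hne').1 hy _
          (FractionalIdeal.mem_coeIdeal_of_mem _ (Ideal.subset_span (by simp)))
  · rintro I ⟨hI, hI0, hIt⟩ hmI
    refine hm.2 (fun J hJ hGV => hI ?_) hmI
    have h1 := (tClosure_eq_one_iff I).2 ⟨J, hJ, hGV⟩
    rw [hIt] at h1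
    exact (FractionalIdeal.coeIdeal_eq_one.1 (SetLike.coe_injective h1)).trans Ideal.one_eq_top

lemma exists_le_isTMaximal {I : Ideal D} (h0 : I ≠ ⊥) (hI : ∀ J ≤ I, ¬ IsGV J) :
    ∃ m : Ideal D, I ≤ m ∧ m.IsPrime ∧ IsTMaximal m := by
  obtain ⟨m, hIm, hm⟩ := exists_le_maximal_not_isGV hI
  exact ⟨m, hIm, isPrime_of_maximal_not_isGV hm,
    isTMaximal_of_maximal_not_isGV (fun h => h0 (le_bot_iff.1 (hIm.trans h.le))) hm⟩

/-- A proper principal ideal `(x)` contains no GV ideal, since the GV condition with `a = 1`, `d =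
x` would make `x` a unit. -/
lemma exists_isTMaximal (hD : ¬ IsField D) : ∃ m : Ideal D, m.IsPrime ∧ IsTMaximal m := by
  obtain ⟨x, hx0, hx⟩ := Ring.exists_not_isUnit_of_not_isField hD
  obtain ⟨m, -, h⟩ := exists_le_isTMaximal (I := Ideal.span {x}) (by simpa using hx0) (by
    intro J hJ hGV
    refine hx (isUnit_of_dvd_one (hGV.2 1 x fun j hj => ?_))
    rw [one_mul]
    exact Ideal.mem_span_singleton.1 (hJ hj))
  exact ⟨m, h⟩

lemma TLinked.of_isLocalization (S : Submonoid D) (B : Type*) [CommRing B] [IsDomain B]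
    [Algebra D B] [IsLocalization S B] : TLinked D B :=
  tLinked_iff.2 fun _ hJ => ⟨_, le_rfl, hJ.map_localization S B⟩

lemma TLinked.trans {B A : Type*} [CommRing B] [IsDomain B] [Algebra D B] [CommRing A]
    [IsDomain A] [Algebra D A] [Algebra B A] [IsScalarTower D B A] (h₁ : TLinked D B)
    (h₂ : TLinked B A) : TLinked D A := by
  rw [tLinked_iff] at *
  intro J hJ
  obtain ⟨H, hH, hGV⟩ := h₁ J hJ
  obtain ⟨G, hG, hG'⟩ := h₂ H hGV
  refine ⟨G, hG.trans ((Ideal.map_mono hH).trans ?_), hG'⟩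
  rw [Ideal.map_map, ← IsScalarTower.algebraMap_eq]

end TClosure

/-! ### Evaluation at fractions; `Int(D)` inside an arbitrary field -/

/-- If `f(D) ⊆ B` then `f(S⁻¹D) ⊆ B`, as soon as `S` is inverted in `B`. -/
lemma eval_div_mem {D L : Type*} [CommRing D] [Field L] (ψ : D →+* L) (B : Subring L)
    (hB : ∀ d, ψ d ∈ B) {s : D} (hs0 : ψ s ≠ 0) (hs : (ψ s)⁻¹ ∈ B) (f : L[X])
    (hf : ∀ d, f.eval (ψ d) ∈ B) (d : D) : f.eval (ψ d / ψ s) ∈ B := by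
  suffices ∀ n : ℕ, ∀ f : L[X], f.degree < n → (∀ d, f.eval (ψ d) ∈ B) →
      f.eval (ψ d / ψ s) ∈ B from
    this (f.natDegree + 1) f (f.degree_le_natDegree.trans_lt (by exact_mod_cast Nat.lt_succ_self _))
      hf
  clear f hf
  intro n
  induction n with
  | zero =>
    intro f hf _
    have : f = 0 := by
      rw [← Polynomial.degree_eq_bot]
      exact Nat.WithBot.lt_zero_iff.1 (by simpa using hf)
    simp [this, B.zero_mem]
  | succ n ih =>
    intro f hdeg hf
    -- In `f(sX) - sⁿ f(X)` the coefficients of degree `n` cancel, so induction applies. Its value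
    -- at `d/s` is `f(d) - sⁿ f(d/s)`, which is solved for `f(d/s)` by inverting `sⁿ` in `B`.
    have hg := ih (f.comp (Polynomial.C (ψ s) * Polynomial.X) - Polynomial.C (ψ s ^ n) * f) (by
      rw [Polynomial.degree_lt_iff_coeff_zero] at hdeg ⊢
      intro m hm
      rw [Polynomial.coeff_sub, Polynomial.comp_C_mul_X_coeff, Polynomial.coeff_C_mul]
      rcases hm.eq_or_lt with rfl | hm
      · ring
      · rw [hdeg m hm]; ring) (by
      intro x
      have := hf (s * x)
      rw [map_mul] at this
      simpa using B.sub_mem this (B.mul_mem (B.pow_mem (hB s) n) (hf x)))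
    simp only [Polynomial.eval_sub, Polynomial.eval_comp, Polynomial.eval_mul, Polynomial.eval_C,
      Polynomial.eval_X, mul_div_cancel₀ _ hs0] at hg
    have h1 := B.mul_mem (B.pow_mem hs n) (B.sub_mem (hf d) hg)
    have h2 : (ψ s)⁻¹ ^ n * (f.eval (ψ d) - (f.eval (ψ d) - ψ s ^ n * f.eval (ψ d / ψ s))) =
        f.eval (ψ d / ψ s) := by
      rw [sub_sub_cancel, inv_pow, inv_mul_cancel_left₀ (pow_ne_zero n hs0)]
    rwa [h2] at h1

/-- The image of `Int(D)` in `L[X]`, for a field `L` that contains `D`. -/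
def intOver {D L : Type*} [CommRing D] [Field L] (ψ : D →+* L) : Set L[X] :=
  {f | (∃ d : D, d ≠ 0 ∧ Polynomial.C (ψ d) * f ∈ Polynomial.lifts ψ) ∧
    ∀ x : D, ∃ y : D, f.eval (ψ x) = ψ y}

section

variable {D : Type*} [CommRing D]

lemma mem_intPoly_iff {A : Type*} [CommRing A] [IsDomain A] [Algebra D A]
    {f : (FractionRing A)[X]} : f ∈ IntPoly D A ↔ ∀ d : D, ∃ a : A,
      f.eval (algebraMap A (FractionRing A) (algebraMap D A d)) =
        algebraMap A (FractionRing A) a := by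
  change (∀ x ∈ Set.range _, _) ↔ _
  rw [Set.forall_mem_range]
  simp only [Algebra.mem_bot, Set.mem_range, eq_comm]

lemma map_mem_span_intOver {A L L' : Type*} [CommRing A] [Field L] [Field L'] [Algebra A L]
    [Algebra A L'] [Algebra D A] (e : L →ₐ[A] L') {f : L[X]}
    (hf : f ∈ Submodule.span A (intOver ((algebraMap A L).comp (algebraMap D A)))) :
    f.map (e : L →+* L') ∈
      Submodule.span A (intOver ((algebraMap A L').comp (algebraMap D A))) := by
  have h1 := Submodule.mem_map_of_mem (f := (Polynomial.mapAlgHom e).toLinearMap) hf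
  rw [Submodule.map_span] at h1
  refine Submodule.span_mono ?_ h1
  rintro _ ⟨g, ⟨⟨d, hd0, hd⟩, hg⟩, rfl⟩
  have he : (e : L →+* L').comp ((algebraMap A L).comp (algebraMap D A)) =
      (algebraMap A L').comp (algebraMap D A) := by
    rw [← RingHom.comp_assoc, AlgHom.comp_algebraMap]
  refine ⟨⟨d, hd0, ?_⟩, fun x => ?_⟩
  · obtain ⟨q, hq⟩ := (Polynomial.mem_lifts _).1 hd
    refine (Polynomial.mem_lifts _).2 ⟨q, ?_⟩
    rw [← he, ← Polynomial.map_map, hq]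
    simp
  · obtain ⟨y, hy⟩ := hg x
    refine ⟨y, ?_⟩
    rw [← he, RingHom.comp_apply, RingHom.comp_apply _ _ y, ← hy]
    exact Polynomial.eval_map_apply _ _

/-- Whether `Int(D, A)` is generated by `Int(D)` can be tested in any quotient field of `A`. -/
lemma forall_mem_span_intOver_of_algEquiv {A L L' : Type*} [CommRing A] [Field L] [Field L']
    [Algebra A L] [Algebra A L'] [Algebra D A] (e : L ≃ₐ[A] L')
    (H : ∀ f : L[X],
      (∀ d : D, ∃ a : A, f.eval (algebraMap A L (algebraMap D A d)) = algebraMap A L a) →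
        f ∈ Submodule.span A (intOver ((algebraMap A L).comp (algebraMap D A))))
    (f : L'[X])
    (hf : ∀ d : D, ∃ a : A, f.eval (algebraMap A L' (algebraMap D A d)) = algebraMap A L' a) :
    f ∈ Submodule.span A (intOver ((algebraMap A L').comp (algebraMap D A))) := by
  obtain ⟨g, rfl⟩ : ∃ g : L[X], f = g.map ((e : L →ₐ[A] L') : L →+* L') :=
    ⟨f.map ((e.symm : L' →ₐ[A] L) : L' →+* L), by
      ext n
      simp [Polynomial.coeff_map]⟩
  refine map_mem_span_intOver (e : L →ₐ[A] L') (H g fun d => ?_)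
  obtain ⟨a, ha⟩ := hf d
  refine ⟨a, e.injective ?_⟩
  rw [e.commutes, ← ha, ← e.commutes]
  exact (Polynomial.eval_map_apply ((e : L →ₐ[A] L') : L →+* L') _).symm

variable [IsDomain D]

lemma exists_map_eq_of_mul_mem_lifts {L : Type*} [Field L] (σ : FractionRing D →+* L) {f : L[X]}
    {d : D} (hd0 : d ≠ 0) (hd : Polynomial.C (σ.comp (algebraMap D (FractionRing D)) d) * f ∈
      Polynomial.lifts (σ.comp (algebraMap D (FractionRing D)))) :
    ∃ g : (FractionRing D)[X], g.map σ = f := by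
  obtain ⟨h, hh⟩ := (Polynomial.mem_lifts _).1 hd
  have hd1 : algebraMap D (FractionRing D) d ≠ 0 :=
    fun e => hd0 (IsFractionRing.to_map_eq_zero_iff.1 e)
  have hd2 : σ (algebraMap D (FractionRing D) d) ≠ 0 := by simpa using hd1
  refine ⟨Polynomial.C (algebraMap D (FractionRing D) d)⁻¹ *
      h.map (algebraMap D (FractionRing D)), ?_⟩
  rw [Polynomial.map_mul, Polynomial.map_map, hh, Polynomial.map_C, ← mul_assoc,
    ← Polynomial.C_mul, RingHom.comp_apply, map_inv₀, inv_mul_cancel₀ hd2]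
  simp

lemma image_intPoly_eq_intOver {L : Type*} [Field L] (σ : FractionRing D →+* L) :
    Polynomial.map σ '' (IntPoly D D : Set (FractionRing D)[X]) =
      intOver (σ.comp (algebraMap D (FractionRing D))) := by
  ext f
  constructor
  · rintro ⟨g, hg, rfl⟩
    rw [SetLike.mem_coe, mem_intPoly_iff] at hg
    refine ⟨?_, fun x => ?_⟩
    · obtain ⟨b, hb0, hb⟩ := IsLocalization.integerNormalization_spec D⁰ g
      refine ⟨b, nonZeroDivisors.ne_zero hb0, (Polynomial.mem_lifts _).2
        ⟨IsLocalization.integerNormalization D⁰ g, ?_⟩⟩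
      rw [← Polynomial.map_map, hb, Algebra.smul_def, Polynomial.map_mul]
      simp [Polynomial.algebraMap_apply]
    · obtain ⟨y, hy⟩ := hg x
      refine ⟨y, ?_⟩
      rw [RingHom.comp_apply, Polynomial.eval_map_apply, RingHom.comp_apply, ← hy]
      rfl
  · rintro ⟨⟨d, hd0, hd⟩, hf⟩
    obtain ⟨g, rfl⟩ := exists_map_eq_of_mul_mem_lifts σ hd0 hd
    refine ⟨g, ?_, rfl⟩
    rw [SetLike.mem_coe, mem_intPoly_iff]
    intro x
    obtain ⟨y, hy⟩ := hf x
    refine ⟨y, σ.injective ?_⟩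
    rw [RingHom.comp_apply, Polynomial.eval_map_apply] at hy
    exact hy

/-- Working form of regularity: the quotient field is arbitrary, so one field can serve both `D` and
a localization, and the automatic inclusion of the span in `Int(D, A)` is dropped. -/
lemma polynomiallyRegular_iff {A : Type*} [CommRing A] [IsDomain A] [Algebra D A] (L : Type*)
    [Field L] [Algebra A L] [IsFractionRing A L] (h : Function.Injective (algebraMap D A)) :
    PolynomiallyRegular D A h ↔ ∀ f : L[X],
      (∀ d : D, ∃ a : A, f.eval (algebraMap A L (algebraMap D A d)) = algebraMap A L a) →
        f ∈ Submodule.span A (intOver ((algebraMap A L).comp (algebraMap D A))) := by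
  have hcomp : (IsFractionRing.map (K := FractionRing D) (L := FractionRing A) h).comp
      (algebraMap D (FractionRing D)) =
        (algebraMap A (FractionRing A)).comp (algebraMap D A) := by
    ext x
    simp [IsFractionRing.map]
  have step : PolynomiallyRegular D A h ↔ ∀ f : (FractionRing A)[X], f ∈ IntPoly D A →
      f ∈ Submodule.span A (intOver ((algebraMap A (FractionRing A)).comp (algebraMap D A))) := by
    rw [PolynomiallyRegular, image_intPoly_eq_intOver, hcomp]
    refine ⟨fun h f hf => by rw [h]; exact hf, fun h => le_antisymm ?_ fun f hf => h f hf⟩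
    rw [Submodule.span_le]
    rintro f ⟨-, hf⟩
    refine mem_intPoly_iff.2 fun d => ?_
    obtain ⟨y, hy⟩ := hf d
    exact ⟨_, hy⟩
  rw [step]
  simp only [mem_intPoly_iff]
  exact ⟨forall_mem_span_intOver_of_algEquiv (FractionRing.algEquiv A L),
    forall_mem_span_intOver_of_algEquiv (FractionRing.algEquiv A L).symm⟩

end

/-! ### L-regularity and common denominators -/

section

variable {D : Type*} [CommRing D] [IsDomain D]

/-- By `eval_div_mem`, mapping `S⁻¹D` into itself need only be tested on `D`; the inclusion
`S⁻¹Int(D) ⊆ Int(S⁻¹D)` always holds. -/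
lemma polynomiallyLRegular_iff :
    PolynomiallyLRegular D ↔ ∀ S : Submonoid D, S ≤ D⁰ → ∀ f : (FractionRing D)[X],
      (∀ d : D, ∃ a : D, ∃ s ∈ S, f.eval (algebraMap D (FractionRing D) d) =
        algebraMap D (FractionRing D) a * (algebraMap D (FractionRing D) s)⁻¹) →
      ∃ s ∈ S, s • f ∈ IntPoly D D := by
  have hmem : ∀ (S : Submonoid D) (hS : S ≤ D⁰) (x : FractionRing D),
      x ∈ Localization.subalgebra.ofField (FractionRing D) S hS ↔ ∃ a : D, ∃ s ∈ S,
        x = algebraMap D (FractionRing D) a * (algebraMap D (FractionRing D) s)⁻¹ := by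
    intro S hS x
    simp only [← exists_prop]
    exact Iff.rfl
  have hsub : ∀ (S : Submonoid D) (hS : S ≤ D⁰) (f : (FractionRing D)[X]),
      f ∈ (polysInto (Localization.subalgebra.ofField (FractionRing D) S hS : Set (FractionRing D))
        (Localization.subalgebra.ofField (FractionRing D) S hS) : Set (FractionRing D)[X]) ↔
      ∀ d : D, f.eval (algebraMap D (FractionRing D) d) ∈
        Localization.subalgebra.ofField (FractionRing D) S hS := by
    intro S hS f
    refine ⟨fun h d => h _ (Subalgebra.algebraMap_mem _ d), fun h x hx => ?_⟩
    obtain ⟨a, s, hs, rfl⟩ := (hmem S hS x).1 hx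
    have hs0 : algebraMap D (FractionRing D) s ≠ 0 :=
      IsFractionRing.to_map_ne_zero_of_mem_nonZeroDivisors (hS hs)
    rw [← div_eq_mul_inv]
    exact eval_div_mem (algebraMap D (FractionRing D))
      (Localization.subalgebra.ofField (FractionRing D) S hS).toSubring
      (fun d => Subalgebra.algebraMap_mem _ d) hs0
      ((hmem S hS _).2 ⟨1, s, hs, by simp⟩) f h a
  refine forall_congr' fun S => forall_congr' fun hS => ?_
  rw [Set.ext_iff]
  simp only [hsub, hmem, Set.mem_ofPred_eq]
  refine forall_congr' fun f => ⟨fun h => h.1, fun h => ⟨h, ?_⟩⟩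
  rintro ⟨s, hs, hf⟩ d
  have hs0 : algebraMap D (FractionRing D) s ≠ 0 :=
    IsFractionRing.to_map_ne_zero_of_mem_nonZeroDivisors (hS hs)
  obtain ⟨a, ha⟩ := mem_intPoly_iff.1 hf d
  refine ⟨a, s, hs, ?_⟩
  rw [Polynomial.eval_smul, Algebra.smul_def, Algebra.algebraMap_self, RingHom.id_apply] at ha
  rw [← ha]
  field_simp

lemma C_mem_intOver {L : Type*} [Field L] (ψ : D →+* L) (d : D) :
    Polynomial.C (ψ d) ∈ intOver ψ :=
  ⟨⟨1, one_ne_zero, (Polynomial.mem_lifts _).2 ⟨Polynomial.C d, by simp⟩⟩, fun _ => ⟨d, by simp⟩⟩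

lemma mul_mem_intOver {L : Type*} [Field L] {ψ : D →+* L} {f g : L[X]} (hf : f ∈ intOver ψ)
    (hg : g ∈ intOver ψ) : f * g ∈ intOver ψ := by
  obtain ⟨⟨c, hc0, hc⟩, hf⟩ := hf
  obtain ⟨⟨d, hd0, hd⟩, hg⟩ := hg
  refine ⟨⟨c * d, mul_ne_zero hc0 hd0, ?_⟩, fun x => ?_⟩
  · rw [map_mul, map_mul, mul_mul_mul_comm]
    exact mul_mem hc hd
  · obtain ⟨y, hy⟩ := hf x
    obtain ⟨z, hz⟩ := hg x
    exact ⟨y * z, by simp [hy, hz]⟩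

lemma add_mem_intOver {L : Type*} [Field L] {ψ : D →+* L} {f g : L[X]} (hf : f ∈ intOver ψ)
    (hg : g ∈ intOver ψ) : f + g ∈ intOver ψ := by
  obtain ⟨⟨c, hc0, hc⟩, hf⟩ := hf
  obtain ⟨⟨d, hd0, hd⟩, hg⟩ := hg
  have hC : ∀ a : D, Polynomial.C (ψ a) ∈ Polynomial.lifts ψ := fun a =>
    Polynomial.C_mem_lifts ψ a
  refine ⟨⟨c * d, mul_ne_zero hc0 hd0, ?_⟩, fun x => ?_⟩
  · have : Polynomial.C (ψ (c * d)) * (f + g) = Polynomial.C (ψ d) * (Polynomial.C (ψ c) * f) +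
        Polynomial.C (ψ c) * (Polynomial.C (ψ d) * g) := by
      rw [map_mul, map_mul]; ring
    rw [this]
    exact add_mem (mul_mem (hC d) hc) (mul_mem (hC c) hd)
  · obtain ⟨y, hy⟩ := hf x
    obtain ⟨z, hz⟩ := hg x
    exact ⟨y + z, by simp [hy, hz]⟩

/-- For a localization `B` of `D`, every element of `S⁻¹ Int(D)` is a quotient. -/
lemma exists_mul_mem_of_mem_span_intOver {B L : Type*} [CommRing B] [Field L] [Algebra D B]
    [Algebra B L] (S : Submonoid D) [IsLocalization S B] {f : L[X]}
    (hf : f ∈ Submodule.span B (intOver ((algebraMap B L).comp (algebraMap D B)))) :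
    ∃ s ∈ S, Polynomial.C (algebraMap B L (algebraMap D B s)) * f ∈
      intOver ((algebraMap B L).comp (algebraMap D B)) := by
  set ψ := (algebraMap B L).comp (algebraMap D B) with hψ
  change ∃ s ∈ S, Polynomial.C (ψ s) * f ∈ intOver ψ
  induction hf using Submodule.span_induction with
  | mem f hf => exact ⟨1, S.one_mem, by simpa using hf⟩
  | zero => exact ⟨1, S.one_mem, by simpa using C_mem_intOver ψ 0⟩
  | add f g _ _ hf hg =>
    obtain ⟨s, hs, hf⟩ := hf
    obtain ⟨t, ht, hg⟩ := hg
    refine ⟨s * t, S.mul_mem hs ht, ?_⟩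
    have : Polynomial.C (ψ (s * t)) * (f + g) = Polynomial.C (ψ t) * (Polynomial.C (ψ s) * f) +
        Polynomial.C (ψ s) * (Polynomial.C (ψ t) * g) := by
      rw [map_mul, map_mul]; ring
    rw [this]
    exact add_mem_intOver (mul_mem_intOver (C_mem_intOver ψ t) hf)
      (mul_mem_intOver (C_mem_intOver ψ s) hg)
  | smul b f _ hf =>
    obtain ⟨s, hs, hf⟩ := hf
    obtain ⟨⟨a, t⟩, hat⟩ := IsLocalization.surj S b
    simp only at hat
    refine ⟨s * t, S.mul_mem hs t.2, ?_⟩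
    have : Polynomial.C (ψ (s * t)) * (b • f) =
        Polynomial.C (ψ a) * (Polynomial.C (ψ s) * f) := by
      rw [hψ, RingHom.comp_apply, RingHom.comp_apply, RingHom.comp_apply, ← hat,
        Algebra.smul_def, Polynomial.algebraMap_apply]
      simp only [map_mul]
      ring
    rw [this]
    exact mul_mem_intOver (C_mem_intOver ψ a) hf

lemma PolynomiallyTRegular.polynomiallyLRegular {D : Type u} [CommRing D] [IsDomain D]
    (h : PolynomiallyTRegular D) : PolynomiallyLRegular D := by
  rw [polynomiallyLRegular_iff]
  intro S hS f hf
  let B := Localization.subalgebra.ofField (FractionRing D) S hS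
  have hinj : Function.Injective (algebraMap D B) := fun x y hxy =>
    IsFractionRing.injective D (FractionRing D) (congrArg Subtype.val hxy)
  have hreg := (polynomiallyRegular_iff (FractionRing D) hinj).1
    (h B hinj (TLinked.of_isLocalization S B)) f (fun d => by
      obtain ⟨a, s, hs, e⟩ := hf d
      exact ⟨⟨_, a, s, hs, rfl⟩, e⟩)
  obtain ⟨s, hs, hsf⟩ := exists_mul_mem_of_mem_span_intOver S hreg
  refine ⟨s, hs, mem_intPoly_iff.2 fun d => ?_⟩
  obtain ⟨y, hy⟩ := hsf.2 d
  refine ⟨y, ?_⟩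
  rw [Polynomial.eval_mul, Polynomial.eval_C] at hy
  rw [Polynomial.eval_smul, Algebra.smul_def]
  exact hy

end

/-! ### Transfer between `D` and its localizations -/

lemma exists_eval_eq_of_isLocalization {D B A L : Type*} [CommRing D] [CommRing B] [CommRing A]
    [Field L] [Algebra D B] (S : Submonoid D) [IsLocalization S B] (β : B →+* A) (ι : A →+* L)
    {f : L[X]} (hf : ∀ d : D, ∃ a : A, f.eval (ι (β (algebraMap D B d))) = ι a) (b : B) :
    ∃ a : A, f.eval (ι (β b)) = ι a := by
  obtain ⟨⟨d, s⟩, hd⟩ := IsLocalization.surj S b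
  simp only at hd
  obtain ⟨u, hu⟩ := (IsLocalization.map_units B s).map β
  have h0 : ι (β (algebraMap D B s)) ≠ 0 :=
    (((IsLocalization.map_units B s).map β).map ι).ne_zero
  have h1 : ι (β b) = ι (β (algebraMap D B d)) / ι (β (algebraMap D B s)) := by
    rw [eq_div_iff h0, ← map_mul, ← map_mul, hd]
  have := eval_div_mem (ι.comp (β.comp (algebraMap D B))) ι.range (fun d => ⟨_, rfl⟩) h0
    ⟨(u⁻¹ : Aˣ), by
      refine eq_inv_of_mul_eq_one_left ?_
      simp only [RingHom.comp_apply]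
      rw [← map_mul, ← hu, Units.inv_mul, map_one]⟩ f (fun d => by
        obtain ⟨a, ha⟩ := hf d
        exact ⟨a, ha.symm⟩) d
  rw [h1]
  obtain ⟨a, ha⟩ := this
  exact ⟨a, ha.symm⟩

lemma intOver_subset_of_isLocalization {D B L : Type*} [CommRing D] [IsDomain D] [CommRing B]
    [IsDomain B] [Field L] [Algebra D B] (ι : B →+* L) (S : Submonoid D) [IsLocalization S B]
    (hinj : Function.Injective (algebraMap D B)) :
    intOver (ι.comp (algebraMap D B)) ⊆ intOver ι := by
  rintro f ⟨⟨d, hd0, hd⟩, hf⟩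
  refine ⟨⟨algebraMap D B d, fun e => hd0 (hinj (by simpa using e)), ?_⟩, fun x => ?_⟩
  · obtain ⟨q, hq⟩ := (Polynomial.mem_lifts _).1 hd
    exact (Polynomial.mem_lifts _).2 ⟨q.map (algebraMap D B), by rw [Polynomial.map_map, hq]; rfl⟩
  · exact exists_eval_eq_of_isLocalization S (RingHom.id B) ι (fun d => by
      obtain ⟨y, hy⟩ := hf d
      exact ⟨_, hy⟩) x

/-- Polynomial regularity over `D` of an extension of a localization `B` of `D` implies polynomial
regularity over `B`. -/
lemma PolynomiallyRegular.of_isLocalization {D B A : Type*} [CommRing D] [IsDomain D] [CommRing B]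
    [IsDomain B] [CommRing A] [IsDomain A] [Algebra D B] [Algebra B A] [Algebra D A]
    [IsScalarTower D B A] (S : Submonoid D) [IsLocalization S B]
    {hDA : Function.Injective (algebraMap D A)} (hBA : Function.Injective (algebraMap B A))
    (h : PolynomiallyRegular D A hDA) : PolynomiallyRegular B A hBA := by
  rw [polynomiallyRegular_iff (FractionRing A)] at h ⊢
  intro f hf
  have hDB : Function.Injective (algebraMap D B) := by
    rw [IsScalarTower.algebraMap_eq D B A] at hDA
    exact Function.Injective.of_comp hDA
  rw [IsScalarTower.algebraMap_eq D B A, ← RingHom.comp_assoc] at h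
  refine Submodule.span_mono ?_ (h f fun d => hf (algebraMap D B d))
  exact intOver_subset_of_isLocalization _ S hDB

lemma PolynomiallyTRegular.localization {D : Type u} [CommRing D] [IsDomain D]
    (h : PolynomiallyTRegular D) (p : Ideal D) [p.IsPrime] :
    PolynomiallyTRegular (Localization.AtPrime p) := by
  intro A _ _ _ hinj hA
  let : Algebra D A := ((algebraMap (Localization.AtPrime p) A).comp
    (algebraMap D (Localization.AtPrime p))).toAlgebra
  have : IsScalarTower D (Localization.AtPrime p) A := .of_algebraMap_eq fun _ => rfl
  exact PolynomiallyRegular.of_isLocalization p.primeCompl hinj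
    (h A (hinj.comp (IsLocalization.injective _ p.primeCompl_le_nonZeroDivisors))
      ((TLinked.of_isLocalization p.primeCompl _).trans hA))

lemma PolynomiallyTRegular.absolutelyPolynomiallyRegular {D : Type u} [CommRing D] [IsDomain D]
    (h : PolynomiallyTRegular D) (p : Ideal D) [p.IsPrime] (hp : IsTMaximal p) :
    AbsolutelyPolynomiallyRegular (Localization.AtPrime p) := by
  intro A _ _ _ hinj
  let : Algebra D A := ((algebraMap (Localization.AtPrime p) A).comp
    (algebraMap D (Localization.AtPrime p))).toAlgebra
  have : IsScalarTower D (Localization.AtPrime p) A := .of_algebraMap_eq fun _ => rfl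
  refine PolynomiallyRegular.of_isLocalization p.primeCompl hinj
    (h A (hinj.comp (IsLocalization.injective _ p.primeCompl_le_nonZeroDivisors))
      (tLinked_iff.2 fun J hJ => ⟨⊤, ?_, isGV_top⟩))
  -- A GV ideal is not contained in the t-maximal `p`, so it has an element that becomes a unit in
  -- `D_p`, and `JA = A`.
  obtain ⟨x, hxJ, hxp⟩ := Set.not_subset.1 fun hle => hp.not_isGV J hle hJ
  rw [top_le_iff]
  refine Ideal.eq_top_of_isUnit_mem _ (Ideal.mem_map_of_mem _ hxJ) ?_
  rw [IsScalarTower.algebraMap_apply D (Localization.AtPrime p) A]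
  exact (IsLocalization.map_units (Localization.AtPrime p) (⟨x, hxp⟩ : p.primeCompl)).map _

/-! ### Flatness and division by GV ideals -/

section Flat
open TensorProduct

/-- In a flat module, divisibility by `d` can be tested after multiplication by a
Glaz–Vasconcelos ideal. -/
lemma IsGV.exists_eq_smul {A M : Type*} [CommRing A] [AddCommGroup M] [Module A M]
    [Module.Flat A M] {J : Ideal A} (hJ : IsGV J) {d : A} {x : M}
    (h : ∀ j ∈ J, ∃ y : M, j • x = d • y) : ∃ y : M, x = d • y := by
  obtain ⟨n, s, hs⟩ := Submodule.fg_iff_exists_fin_generating_family.1 hJ.1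
  have hsJ : ∀ i, s i ∈ J := fun i => hs ▸ Submodule.subset_span ⟨i, rfl⟩
  choose y hy using fun i => h (s i) (hsJ i)
  -- `F` encodes the relations `sᵢ x = d yᵢ` and `G` sends the basis to `x` and the `yᵢ`. By
  -- flatness `G = β ∘ α` through a finite free module with `α ∘ F = 0`. Coordinatewise `d` divides
  -- `sᵢ α(1, 0)`, so the GV property makes `d` divide `α(1, 0)`, hence `x`.
  let F : (Fin n → A) →ₗ[A] A × (Fin n → A) :=
    (Fintype.linearCombination A s).prod (-d • LinearMap.id)
  let G : A × (Fin n → A) →ₗ[A] M :=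
    (LinearMap.toSpanSingleton A M x).coprod (Fintype.linearCombination A y)
  have hGF : G ∘ₗ F = 0 := by
    refine LinearMap.pi_ext' fun i => LinearMap.ext_ring ?_
    simp [F, G, Fintype.linearCombination_apply_single, ← Pi.single_smul, hy]
  obtain ⟨k, α, β, hαβ, hα⟩ := Module.Flat.exists_factorization_of_comp_eq_zero_of_free hGF
  have hdiv : ∀ l, d ∣ α (1, 0) l := fun l => by
    refine hJ.2 _ _ fun j hj => ?_
    rw [← hs] at hj
    induction hj using Submodule.span_induction with
    | mem j hj =>
      obtain ⟨i, rfl⟩ := hj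
      refine ⟨α (0, Pi.single i 1) l, ?_⟩
      have h1 : α (F (Pi.single i 1)) = 0 := LinearMap.congr_fun hα _
      have h2 : F (Pi.single i 1) = s i • ((1 : A), (0 : Fin n → A)) -
          d • ((0 : A), (Pi.single i 1 : Fin n → A)) := by
        simp [F, Fintype.linearCombination_apply_single]
      rw [h2, map_sub, map_smul, map_smul, sub_eq_zero] at h1
      have h3 := DFunLike.congr_fun h1 l
      simpa [mul_comm] using h3
    | zero => simp
    | add a b _ _ ha hb => rw [mul_add]; exact ha.add hb
    | smul c a _ ha => rw [smul_eq_mul, mul_left_comm]; exact ha.mul_left c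
  choose c hc using hdiv
  have hαc : α (1, 0) = d • Finsupp.equivFunOnFinite.symm c := by
    ext l
    simp [hc]
  refine ⟨β (Finsupp.equivFunOnFinite.symm c), ?_⟩
  rw [← map_smul, ← hαc, ← LinearMap.comp_apply, ← hαβ]
  simp [G]

/-- Let `N` be a flat `D`-module, `P = L ⊗ N`, and let `A` be a `D`-subalgebra of `L`. Then the
`A`-submodule `A ⊗ N` of `P` is closed under division by Glaz–Vasconcelos ideals of `A`. -/
lemma IsGV.mem_span_range {D A L N P : Type*} [CommRing D] [CommRing A] [IsDomain A] [Field L]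
    [Algebra D A] [Algebra A L] [Algebra D L] [IsScalarTower D A L] [AddCommGroup N] [Module D N]
    [Module.Flat D N] [AddCommGroup P] [Module D P] [Module A P] [Module L P]
    [IsScalarTower D L P] [IsScalarTower A L P] [IsScalarTower D A P]
    (hAL : Function.Injective (algebraMap A L)) {j : N →ₗ[D] P} (hj : IsBaseChange L j)
    {J : Ideal A} (hJ : IsGV J) {p : P}
    (h : ∀ a ∈ J, a • p ∈ Submodule.span A (Set.range j)) :
    p ∈ Submodule.span A (Set.range j) := by
  let Φ : A ⊗[D] N →ₗ[A] P := (hj.equiv.toLinearMap.restrictScalars A) ∘ₗ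
    (AlgebraTensorModule.map (Algebra.linearMap A L) LinearMap.id)
  have hΦ : ∀ (a : A) (n : N), Φ (a ⊗ₜ n) = a • j n := by
    intro a n
    simp [Φ, IsBaseChange.equiv_tmul]
  have hinj : Function.Injective Φ := by
    refine hj.equiv.injective.comp ?_
    exact Module.Flat.rTensor_preserves_injective_linearMap (M := N)
      ((Algebra.linearMap A L).restrictScalars D) hAL
  have hrange : LinearMap.range Φ = Submodule.span A (Set.range j) := by
    refine le_antisymm ?_ (Submodule.span_le.2 ?_)
    · rintro _ ⟨t, rfl⟩
      induction t using TensorProduct.induction_on with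
      | zero => simp
      | tmul a n => rw [hΦ]; exact Submodule.smul_mem _ _ (Submodule.subset_span ⟨n, rfl⟩)
      | add x y hx hy => rw [map_add]; exact add_mem hx hy
    · rintro _ ⟨n, rfl⟩
      exact ⟨1 ⊗ₜ n, by rw [hΦ, one_smul]⟩
  rw [← hrange] at h ⊢
  -- Write `d p = Φ x`. For `a ∈ J`, injectivity of `Φ` makes `a x` divisible by `d` in `A ⊗ N`,
  -- which is flat over `A`; so `x = d y`, and cancelling `d` gives `p = Φ y`.
  obtain ⟨d, hd, hd0⟩ := Submodule.exists_mem_ne_zero_of_ne_bot hJ.ne_bot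
  obtain ⟨x, hx⟩ := h d hd
  obtain ⟨y, rfl⟩ := hJ.exists_eq_smul (d := d) (x := x) fun a ha => by
    obtain ⟨y, hy⟩ := h a ha
    refine ⟨y, hinj ?_⟩
    rw [map_smul, map_smul, hx, hy, smul_comm]
  refine ⟨y, ?_⟩
  rw [map_smul, ← algebraMap_smul L, ← algebraMap_smul L d p] at hx
  exact smul_right_injective P ((map_ne_zero_iff _ hAL).2 hd0) hx

end Flat

/-! ### `Int(D)` as a lattice in `L[X]` -/

section

variable {D : Type*} [CommRing D] [IsDomain D]

/-- `K[X]` is the localization of `Int(D)` at the nonzero elements of `D`: clearing denominators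
moves any polynomial into `D[X] ⊆ Int(D)`. -/
lemma isBaseChange_intPoly_val :
    IsBaseChange (FractionRing D) ((IntPoly D D).val.toLinearMap) := by
  rw [← isLocalizedModule_iff_isBaseChange D⁰]
  refine ⟨fun s => ?_, fun f => ?_, fun {x y} h => ⟨1, congrArg _ (Subtype.ext h)⟩⟩
  · rw [Module.End.isUnit_iff]
    have hs : algebraMap D (FractionRing D) s ≠ 0 :=
      IsFractionRing.to_map_ne_zero_of_mem_nonZeroDivisors s.2
    refine ⟨fun f g hfg => smul_right_injective _ hs ?_, fun f =>
      ⟨(algebraMap D (FractionRing D) s)⁻¹ • f, ?_⟩⟩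
    · simpa using hfg
    · rw [Module.algebraMap_end_apply, ← algebraMap_smul (FractionRing D), smul_inv_smul₀ hs]
  · obtain ⟨b, hb0, hb⟩ := IsLocalization.integerNormalization_spec D⁰ f
    refine ⟨(⟨b • f, ?_⟩, ⟨b, hb0⟩), rfl⟩
    rw [← hb, mem_intPoly_iff]
    exact fun d => ⟨_, Polynomial.eval_map_apply _ _⟩

attribute [local instance] Polynomial.algebra in
lemma exists_isBaseChange_intPoly {L : Type*} [Field L] [Algebra D L]
    (hDL : Function.Injective (algebraMap D L)) :
    ∃ j : IntPoly D D →ₗ[D] L[X], IsBaseChange L j ∧ Set.range j = intOver (algebraMap D L) := by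
  let σ : FractionRing D →+* L := IsFractionRing.lift hDL
  let : Algebra (FractionRing D) L := σ.toAlgebra
  have hσ : σ.comp (algebraMap D (FractionRing D)) = algebraMap D L :=
    RingHom.ext fun x => IsFractionRing.lift_algebraMap hDL x
  have : IsScalarTower D (FractionRing D) L := .of_algebraMap_eq' hσ.symm
  refine ⟨_, isBaseChange_intPoly_val.comp
    (Algebra.IsPushout.out (R := FractionRing D) (S := L) (R' := (FractionRing D)[X])
      (S' := L[X])), ?_⟩
  rw [← hσ, ← image_intPoly_eq_intOver]
  ext f
  simp only [Set.mem_range, Set.mem_image, Subtype.exists]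
  exact ⟨fun ⟨g, hg, h⟩ => ⟨g, hg, h⟩, fun ⟨g, hg, h⟩ => ⟨g, hg, h⟩⟩

end

lemma lifts_subset_intOver {D L : Type*} [CommRing D] [Nontrivial D] [Field L] (ψ : D →+* L) :
    (Polynomial.lifts ψ : Set L[X]) ⊆ intOver ψ := by
  intro f hf
  refine ⟨⟨1, one_ne_zero, by simpa using hf⟩, fun x => ?_⟩
  obtain ⟨q, rfl⟩ := (Polynomial.mem_lifts _).1 hf
  exact ⟨q.eval x, Polynomial.eval_map_apply _ _⟩

lemma exists_ne_zero_smul_mem_span_intOver {D A L : Type*} [CommRing D] [Nontrivial D]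
    [CommRing A] [IsDomain A] [Field L] [Algebra A L] [IsFractionRing A L] (ψ : D →+* L)
    (f : L[X]) : ∃ a : A, a ≠ 0 ∧ a • f ∈ Submodule.span A (intOver ψ) := by
  obtain ⟨b, hb0, hb⟩ := IsLocalization.integerNormalization_spec A⁰ f
  refine ⟨b, nonZeroDivisors.ne_zero hb0, ?_⟩
  rw [← hb]
  generalize IsLocalization.integerNormalization A⁰ f = q
  induction q using Polynomial.induction_on' with
  | add p q hp hq => rw [Polynomial.map_add]; exact add_mem hp hq
  | monomial n a =>
    have : (Polynomial.monomial n a).map (algebraMap A L) = a • (Polynomial.X : L[X]) ^ n := by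
      rw [Polynomial.map_monomial, ← Polynomial.C_mul_X_pow_eq_monomial, Algebra.smul_def,
        Polynomial.algebraMap_apply]
    rw [this]
    exact Submodule.smul_mem _ _ (Submodule.subset_span
      (lifts_subset_intOver ψ (pow_mem (Polynomial.X_mem_lifts ψ) n)))

/-- Extensions of an infinite field are polynomially regular. -/
lemma mem_span_intOver_of_isField {D A L : Type*} [CommRing D] [Infinite D] (hD : IsField D)
    [CommRing A] [Field L] [Algebra A L] (ψ : D →+* L) (f : L[X])
    (hf : ∀ d : D, ∃ a : A, f.eval (ψ d) = algebraMap A L a) :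
    f ∈ Submodule.span A (intOver ψ) := by
  let : Field D := hD.toField
  -- Interpolating at enough distinct points of `D` writes `f` with coefficients `f(xᵢ) ∈ A` and
  -- basis polynomials over the field `D`, which are integer-valued.
  let x := Infinite.natEmbedding D
  rw [Lagrange.eq_interpolate (s := Finset.range (f.natDegree + 1)) (v := fun i => ψ (x i))
    (fun i _ j _ h => x.injective (ψ.injective h))
    (f.degree_le_natDegree.trans_lt (by simpa using (by exact_mod_cast Nat.lt_succ_self _))),
    Lagrange.interpolate_apply]
  refine sum_mem fun i _ => ?_
  obtain ⟨a, ha⟩ := hf (x i)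
  rw [ha, ← Polynomial.algebraMap_apply, ← Algebra.smul_def]
  refine Submodule.smul_mem _ _ (Submodule.subset_span (lifts_subset_intOver ψ ?_))
  refine prod_mem fun j _ => (Polynomial.mem_lifts _).2 ⟨Lagrange.basisDivisor (x i) (x j), ?_⟩
  simp [Lagrange.basisDivisor]

/-! ### From local regularity to t-regularity -/

section

variable {D : Type u} [CommRing D] [IsDomain D]

/-- L-regularity concerns polynomials over `K`, so `f` is first shown to come from `K[X]`. -/
lemma PolynomiallyLRegular.exists_mul_mem {D B L : Type*} [CommRing D] [IsDomain D]
    (h : PolynomiallyLRegular D) [CommRing B] [Field L] [Algebra D B] (S : Submonoid D)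
    [IsLocalization S B] (hS : S ≤ D⁰) {ι : B →+* L} (hι : Function.Injective ι) {f : L[X]}
    (hf : f ∈ intOver ι) : ∃ s ∈ S, Polynomial.C (ι (algebraMap D B s)) * f ∈
      intOver (ι.comp (algebraMap D B)) := by
  have hDB : Function.Injective (algebraMap D B) := IsLocalization.injective B hS
  have hinj : Function.Injective (ι.comp (algebraMap D B)) := hι.comp hDB
  let σ : FractionRing D →+* L := IsFractionRing.lift hinj
  have hσ : σ.comp (algebraMap D (FractionRing D)) = ι.comp (algebraMap D B) :=
    RingHom.ext fun x => IsFractionRing.lift_algebraMap hinj x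
  have hσ' : ∀ x, σ (algebraMap D (FractionRing D) x) = ι (algebraMap D B x) :=
    RingHom.congr_fun hσ
  obtain ⟨⟨d, hd0, hd⟩, hf⟩ := hf
  obtain ⟨q, hq⟩ := (Polynomial.mem_lifts _).1 hd
  obtain ⟨b, hbS, hb⟩ := IsLocalization.integerNormalization_spec S q
  obtain ⟨⟨c, s⟩, hc⟩ := IsLocalization.surj S d
  simp only at hc
  have hc0 : c ≠ 0 := by
    rintro rfl
    rw [map_zero] at hc
    exact hd0 ((IsLocalization.map_units B s).mul_left_eq_zero.1 hc)
  obtain ⟨g, rfl⟩ : ∃ g : (FractionRing D)[X], g.map σ = f := by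
    -- With `d f ∈ B[X]`, `s d = c ∈ D`, and `b` clearing the denominators of `d f`, the product `b
    -- c f = s b (d f)` has coefficients in `D`.
    refine exists_map_eq_of_mul_mem_lifts σ
      (mul_ne_zero (nonZeroDivisors.ne_zero (hS hbS)) hc0) ?_
    rw [hσ]
    refine (Polynomial.mem_lifts _).2
      ⟨Polynomial.C (s : D) * IsLocalization.integerNormalization S q, ?_⟩
    rw [← Polynomial.map_map, Polynomial.map_mul, hb, Algebra.smul_def, Polynomial.map_mul,
      Polynomial.map_mul, hq, RingHom.comp_apply, map_mul, ← hc]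
    simp [Polynomial.algebraMap_apply]
    ring
  obtain ⟨t, ht, hg⟩ := polynomiallyLRegular_iff.1 h S hS g fun x => by
    obtain ⟨y, hy⟩ := hf (algebraMap D B x)
    obtain ⟨⟨a, r⟩, ha⟩ := IsLocalization.surj S y
    simp only at ha
    refine ⟨a, r, r.2, σ.injective ?_⟩
    have hr0 : ι (algebraMap D B r) ≠ 0 := ((IsLocalization.map_units B r).map ι).ne_zero
    rw [← hσ', Polynomial.eval_map_apply] at hy
    rw [map_mul, map_inv₀, hσ', hσ', hy, ← ha, map_mul]
    field_simp
  refine ⟨t, ht, ?_⟩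
  rw [← hσ, ← image_intPoly_eq_intOver]
  refine ⟨_, hg, ?_⟩
  rw [Algebra.smul_def, Polynomial.algebraMap_apply, Polynomial.map_mul, Polynomial.map_C, hσ']

lemma PolynomiallyLRegular.exists_notMem_smul_mem_span (hL : PolynomiallyLRegular D)
    {m : Ideal D} [m.IsPrime] (hm : AbsolutelyPolynomiallyRegular (Localization.AtPrime m))
    {A L : Type u} [CommRing A] [IsDomain A] [Algebra D A]
    (hDA : Function.Injective (algebraMap D A)) [Field L] [Algebra A L] [IsFractionRing A L]
    {q : Ideal A} [q.IsPrime] (hqm : q.comap (algebraMap D A) ≤ m) {f : L[X]}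
    (hf : ∀ d : D, ∃ a : A, f.eval (algebraMap A L (algebraMap D A d)) = algebraMap A L a) :
    ∃ u ∉ q, u • f ∈ Submodule.span A (intOver ((algebraMap A L).comp (algebraMap D A))) := by
  let B := Localization.subalgebra.ofField L q.primeCompl q.primeCompl_le_nonZeroDivisors
  have hunit : ∀ s : m.primeCompl, IsUnit ((algebraMap A B).comp (algebraMap D A) s) := fun s =>
    IsLocalization.map_units B (⟨algebraMap D A s, fun hs => s.2 (hqm hs)⟩ : q.primeCompl)
  -- Since `q ∩ D ⊆ m`, elements of `D` outside `m` become units in `B = A_q`, so `A_q` is an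
  -- extension of `D_m`.
  let : Algebra (Localization.AtPrime m) B :=
    (IsLocalization.lift (M := m.primeCompl) hunit).toAlgebra
  have hcomp : ((algebraMap B L).comp (algebraMap (Localization.AtPrime m) B)).comp
      (algebraMap D (Localization.AtPrime m)) = (algebraMap A L).comp (algebraMap D A) := by
    ext x
    change ((IsLocalization.lift (M := m.primeCompl) hunit (algebraMap D _ x) : B) : L) = _
    rw [IsLocalization.lift_eq]
    rfl
  have hinj : Function.Injective (algebraMap (Localization.AtPrime m) B) := by
    refine (IsLocalization.lift_injective_iff (M := m.primeCompl) hunit).2 fun x y => ?_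
    have h1 := IsLocalization.injective (Localization.AtPrime m) m.primeCompl_le_nonZeroDivisors
    have h2 : Function.Injective ((algebraMap A B).comp (algebraMap D A)) :=
      (IsLocalization.injective B q.primeCompl_le_nonZeroDivisors).comp hDA
    rw [h1.eq_iff, h2.eq_iff]
  have hspan := (polynomiallyRegular_iff L hinj).1 (hm B hinj) f
    (exists_eval_eq_of_isLocalization m.primeCompl (algebraMap (Localization.AtPrime m) B)
      (algebraMap B L) fun d => by
        obtain ⟨a, ha⟩ := hf d
        refine ⟨algebraMap A B a, ?_⟩
        rw [← RingHom.comp_apply, ← RingHom.comp_apply, hcomp]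
        exact ha)
  clear hf
  have hιinj : Function.Injective ((algebraMap B L).comp (algebraMap (Localization.AtPrime m) B)) :=
    (IsFractionRing.injective B L).comp hinj
  induction hspan using Submodule.span_induction with
  | mem g hg =>
    obtain ⟨s, hs, hsg⟩ := hL.exists_mul_mem m.primeCompl m.primeCompl_le_nonZeroDivisors hιinj hg
    refine ⟨algebraMap D A s, fun h => hs (hqm h), Submodule.subset_span ?_⟩
    rw [hcomp, ← RingHom.comp_apply _ (algebraMap D (Localization.AtPrime m)) s, hcomp] at hsg
    rw [Algebra.smul_def, Polynomial.algebraMap_apply]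
    exact hsg
  | zero => exact ⟨1, q.primeCompl.one_mem, by simp⟩
  | add f g _ _ hf hg =>
    obtain ⟨s, hs, hf⟩ := hf
    obtain ⟨t, ht, hg⟩ := hg
    refine ⟨s * t, q.primeCompl.mul_mem hs ht, ?_⟩
    rw [smul_add]
    refine add_mem ?_ ?_
    · rw [mul_comm, mul_smul]; exact Submodule.smul_mem _ _ hf
    · rw [mul_smul]; exact Submodule.smul_mem _ _ hg
  | smul b f _ hf =>
    obtain ⟨s, hs, hf⟩ := hf
    obtain ⟨⟨a, t⟩, hat⟩ := IsLocalization.surj q.primeCompl b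
    simp only at hat
    refine ⟨s * t, q.primeCompl.mul_mem hs t.2, ?_⟩
    have : (s * (t : A)) • b • f = a • s • f := by
      rw [mul_smul, ← algebraMap_smul B (t : A), smul_smul, mul_comm _ b, hat, algebraMap_smul,
        smul_comm]
    rw [this]
    exact Submodule.smul_mem _ _ hf

lemma IsGV.mem_span_intOver [Module.Flat D (IntPoly D D)] {A L : Type*} [CommRing A] [IsDomain A]
    [Algebra D A] (hDA : Function.Injective (algebraMap D A)) [Field L] [Algebra A L]
    (hAL : Function.Injective (algebraMap A L)) [Algebra D L] [IsScalarTower D A L] {J : Ideal A}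
    (hJ : IsGV J) {f : L[X]}
    (h : ∀ a ∈ J, a • f ∈ Submodule.span A (intOver (algebraMap D L))) :
    f ∈ Submodule.span A (intOver (algebraMap D L)) := by
  have hDL : Function.Injective (algebraMap D L) := by
    rw [IsScalarTower.algebraMap_eq D A L]
    exact hAL.comp hDA
  obtain ⟨j, hj, hrange⟩ := exists_isBaseChange_intPoly hDL
  rw [← hrange] at h ⊢
  have : IsScalarTower D A L[X] := inferInstance
  have : IsScalarTower D L L[X] := inferInstance
  have : IsScalarTower A L L[X] := inferInstance
  exact IsGV.mem_span_range (D := D) (N := IntPoly D D) (P := L[X]) hAL hj hJ h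

lemma PolynomiallyLRegular.mem_span_intOver [Module.Flat D (IntPoly D D)]
    (hL : PolynomiallyLRegular D) (hreg : ∀ (p : Ideal D) [p.IsPrime], IsTMaximal p →
      AbsolutelyPolynomiallyRegular (Localization.AtPrime p)) (hD : ¬ IsField D)
    {A L : Type u} [CommRing A] [IsDomain A] [Algebra D A]
    (hDA : Function.Injective (algebraMap D A)) (hT : TLinked D A) [Field L] [Algebra A L]
    [IsFractionRing A L] [Algebra D L] [IsScalarTower D A L] {f : L[X]}
    (hf : ∀ d : D, ∃ a : A, f.eval (algebraMap A L (algebraMap D A d)) = algebraMap A L a) :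
    f ∈ Submodule.span A (intOver (algebraMap D L)) := by
  have hψ : (algebraMap A L).comp (algebraMap D A) = algebraMap D L :=
    (IsScalarTower.algebraMap_eq D A L).symm
  have hAL := IsFractionRing.injective A L
  by_contra hfM
  -- The ideal of all `a` with `a f` in the span. It is nonzero by clearing denominators, and
  -- GV-free by flatness.
  let I : Ideal A := (Submodule.span A (intOver (algebraMap D L))).comap
    (LinearMap.toSpanSingleton A L[X] f)
  have hmem : ∀ a, a ∈ I ↔ a • f ∈ Submodule.span A (intOver (algebraMap D L)) :=
    fun a => Iff.rfl
  have hI : ∀ J ≤ I, ¬ IsGV J := fun J hJ hGV =>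
    hfM (hGV.mem_span_intOver hDA hAL fun a ha => (hmem a).1 (hJ ha))
  obtain ⟨a, ha0, ha⟩ := exists_ne_zero_smul_mem_span_intOver (A := A) (algebraMap D L) f
  have hI0 : I ≠ ⊥ := fun h => ha0 (by
    have := (hmem a).2 ha
    rwa [h] at this)
  obtain ⟨q, hIq, hq, hqt⟩ := exists_le_isTMaximal hI0 hI
  obtain ⟨m, hqm, hm, hmt⟩ : ∃ m : Ideal D, q.comap (algebraMap D A) ≤ m ∧ m.IsPrime ∧
      IsTMaximal m := by
    -- Zero is not a t-ideal here, so if `q ∩ D = 0` any t-maximal ideal of `D` will do; this is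
    -- where `D` must not be a field.
    by_cases h0 : q.comap (algebraMap D A) = ⊥
    · obtain ⟨m, hm⟩ := exists_isTMaximal hD
      exact ⟨m, h0 ▸ bot_le, hm⟩
    · refine exists_le_isTMaximal h0 fun J hJ hGV => ?_
      obtain ⟨H, hH, hH'⟩ := tLinked_iff.1 hT J hGV
      exact hqt.not_isGV H (hH.trans (Ideal.map_le_iff_le_comap.2 hJ)) hH'
  obtain ⟨u, hu, huf⟩ := hL.exists_notMem_smul_mem_span (hreg m hmt) hDA hqm hf
  rw [hψ] at huf
  exact hu (hIq ((hmem u).2 huf))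

lemma PolynomiallyLRegular.polynomiallyTRegular [Infinite D] [Module.Flat D (IntPoly D D)]
    (hL : PolynomiallyLRegular D) (hreg : ∀ (p : Ideal D) [p.IsPrime], IsTMaximal p →
      AbsolutelyPolynomiallyRegular (Localization.AtPrime p)) : PolynomiallyTRegular D := by
  intro A _ _ _ hDA hT
  rw [polynomiallyRegular_iff (FractionRing A)]
  intro f hf
  by_cases hD : IsField D
  · exact mem_span_intOver_of_isField hD _ f hf
  · rw [← IsScalarTower.algebraMap_eq D A (FractionRing A)]
    exact hL.mem_span_intOver hreg hD hDA hT hf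

end
end IntegerValued

end

theorem theorem3p7 (D : Type u) [CommRing D] [IsDomain D] :
    (IntegerValued.PolynomiallyTRegular D →
      IntegerValued.PolynomiallyLRegular D ∧
        ∀ (p : Ideal D) [p.IsPrime],
          IntegerValued.PolynomiallyTRegular (Localization.AtPrime p)) ∧
    (IntegerValued.PolynomiallyTRegular D →
      IntegerValued.PolynomiallyLRegular D ∧
        ∀ (p : Ideal D) [p.IsPrime], IntegerValued.IsTMaximal p →
          IntegerValued.AbsolutelyPolynomiallyRegular (Localization.AtPrime p)) ∧
    (Infinite D → Module.Flat D (IntegerValued.IntPoly D D) →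
      (IntegerValued.PolynomiallyTRegular D ↔
        IntegerValued.PolynomiallyLRegular D ∧
          ∀ (p : Ideal D) [p.IsPrime], IntegerValued.IsTMaximal p →
            IntegerValued.AbsolutelyPolynomiallyRegular (Localization.AtPrime p))) :=
  ⟨fun h => ⟨h.polynomiallyLRegular, fun p _ => h.localization p⟩,
    fun h => ⟨h.polynomiallyLRegular, fun p _ hp => h.absolutelyPolynomiallyRegular p hp⟩,
    fun _ _ => ⟨fun h => ⟨h.polynomiallyLRegular,
      fun p _ hp => h.absolutelyPolynomiallyRegular p hp⟩,
      fun h => h.1.polynomiallyTRegular h.2⟩⟩
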